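/- Let $u_\gamma$ be one of the classical weights: Hermite, $u(x)=e^{-x^2}$ on $\Omega=\mathbb R$ (no parameter); Laguerre, $u_\alpha(x)=x^{\alpha}e^{-x}$ on $\Omega=(0,\infty)$ with $\alpha>-1$; or Jacobi, $u_{\alpha,\beta}(x)=(1-x)^{\alpha}(1+x)^{\beta}$ on $\Omega=(-1,1)$ with $\alpha,\beta>-1$. Let $u_{\gamma+1}$ be the weight of the same family with every parameter increased by $1$ (in the Hermite case $u_{\gamma+1}=u_\gamma$), let $\lambda>0$, and put $$\langle f,h\rangle_\gamma=\int_\Omega f h\,u_\gamma\,dx,\qquad (f,h)=\int_\Omega f h\,u_\gamma\,dx+\lambda\int_\Omega f'h'\,u_{\gamma+1}\,dx .$$ The moment matrix of a bilinear form $B$ is $G=(B(x^i,x^j))_{i,j\ge 0}$. It admits an LU factorization if all its leading principal minors are nonzero; then $G=S_1^{-1}H(S_2^{-1})^{\top}$ with $S_1,S_2$ lower triangular with unit diagonal and $H=\mathrm{diag}(h_0,h_1,\dots)$. The monic bi-orthogonal polynomials of $B$ are $P_{1,k}=\sum_{j\le k}(S_1)_{k,j}x^j$ and $P_{2,k}=\sum_{j\le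 k}(S_2)_{k,j}x^j$, and the $h_k$ are called their norms. Then all the integrals above converge when $f$ and $h$ are polynomials, the form $(\cdot,\cdot)$ is positive definite on $\mathbb R[x]$, and the moment matrices of $\langle\cdot,\cdot\rangle_\gamma$, $\langle\cdot,\cdot\rangle_{\gamma+1}$ and $(\cdot,\cdot)$ admit LU factorizations. Let $h_{\gamma,k}$, $h_{\gamma+1,k}$, $\breve h_k$ be the corresponding norms. The two polynomial sequences of $\langle\cdot,\cdot\rangle_\gamma$ coincide and form the sequence $P_{\gamma,k}$ of monic classical orthogonal polynomials, $\langle P_{\gamma,r},P_{\gamma,k}\rangle_\gamma=h_{\gamma,k}\delta_{r,k}$. The two polynomial sequences of $(\cdot,\cdot)$ also coincide, and for their common value $\breve P_k$ and all $k\ge 0$ $$\breve P_k(x)=P_{\gamma,k}(x),\qquad \breve h_k=h_{\gamma,k}+\lambda k^2h_{\gamma+1,k-1}$$ (the last term being $0$ for $k=0$). In particular $(P_{\gamma,r},P_{\gamma,k})=\delta_{r,k}\left(h_{\gamma,k}+\lambda k^2h_{\gamma+1,k-1}\right)$ for all $r,k\ge 0$. -/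

import Mathlib

open MeasureTheory Polynomial

/-- The classical weights, together with their parameters `γ`. -/
inductive ClassicalParam where
  | hermite : ClassicalParam
  | laguerre (α : ℝ) : ClassicalParam
  | jacobi (α β : ℝ) : ClassicalParam

namespace ClassicalParam

/-- The range of the parameters: `α > -1` (Laguerre), `α, β > -1` (Jacobi). -/
def Admissible : ClassicalParam → Prop
  | hermite => True
  | laguerre α => -1 < α
  | jacobi α β => -1 < α ∧ -1 < β

/-- The interval that carries the weight. -/
def domain : ClassicalParam → Set ℝ
  | hermite => Set.univ
  | laguerre _ => Set.Ioi 0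
  | jacobi _ _ => Set.Ioo (-1) 1

/-- The weight `u_γ`; only its values on `γ.domain` matter. -/
noncomputable def weight : ClassicalParam → ℝ → ℝ
  | hermite, x => Real.exp (-x ^ 2)
  | laguerre α, x => x ^ α * Real.exp (-x)
  | jacobi α β, x => (1 - x) ^ α * (1 + x) ^ β

/-- The shift `γ ↦ γ + 1` of all the parameters. -/
def succ : ClassicalParam → ClassicalParam
  | hermite => hermite
  | laguerre α => laguerre (α + 1)
  | jacobi α β => jacobi (α + 1) (β + 1)

/-- `⟨f, h⟩_γ = ∫ f h u_γ`. -/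
noncomputable def form (γ : ClassicalParam) (f h : ℝ → ℝ) : ℝ :=
  ∫ x in γ.domain, f x * h x * γ.weight x

/-- `(f, h) = ∫ f h u_γ + lam ∫ f' h' u_{γ+1}`. -/
noncomputable def sobolevForm (γ : ClassicalParam) (lam : ℝ) (f h : ℝ → ℝ) : ℝ :=
  γ.form f h + lam * γ.succ.form (deriv f) (deriv h)

end ClassicalParam

/-- The moment matrix `(x^i, x^j)` of a bilinear form on functions. -/
def momentMatrix (B : (ℝ → ℝ) → (ℝ → ℝ) → ℝ) : Matrix ℕ ℕ ℝ :=
  Matrix.of fun i j => B (fun x => x ^ i) (fun x => x ^ j)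

/-- The truncation `G^[k]`, consisting of the rows and columns `0, …, k - 1`. -/
def truncation (G : Matrix ℕ ℕ ℝ) (k : ℕ) : Matrix (Fin k) (Fin k) ℝ :=
  G.submatrix Fin.val Fin.val

/-- `G` admits an LU factorization: all its leading principal minors are nonzero. -/
def AdmitsLU (G : Matrix ℕ ℕ ℝ) : Prop :=
  ∀ k : ℕ, (truncation G k).det ≠ 0

/-- Semi-infinite lower triangular matrices with ones on the diagonal. -/
def IsLowerUnitriangular (S : Matrix ℕ ℕ ℝ) : Prop :=
  (∀ i j, i < j → S i j = 0) ∧ ∀ i, S i i = 1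

/-- The product `A B` of semi-infinite matrices whose left factor `A` is lower triangular
(so that only the entries `A i k` with `k ≤ i` contribute). -/
def lowerMul (A B : Matrix ℕ ℕ ℝ) : Matrix ℕ ℕ ℝ :=
  Matrix.of fun i j => ∑ k ∈ Finset.range (i + 1), A i k * B k j

/-- `L` is the inverse of `S` in the group of lower unitriangular matrices. -/
def IsLowerInverse (S L : Matrix ℕ ℕ ℝ) : Prop :=
  IsLowerUnitriangular L ∧ lowerMul S L = 1 ∧ lowerMul L S = 1

/-- An LU factorization `G = S₁⁻¹ H (S₂⁻¹)ᵀ` of a semi-infinite matrix, with `S₁`, `S₂` lower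
unitriangular and `H = diag (h 0, h 1, …)`. -/
structure LUFactorization (G : Matrix ℕ ℕ ℝ) where
  S₁ : Matrix ℕ ℕ ℝ
  S₂ : Matrix ℕ ℕ ℝ
  h : ℕ → ℝ
  lower₁ : IsLowerUnitriangular S₁
  lower₂ : IsLowerUnitriangular S₂
  factor : ∃ L₁ L₂ : Matrix ℕ ℕ ℝ, IsLowerInverse S₁ L₁ ∧ IsLowerInverse S₂ L₂ ∧
    G = lowerMul (lowerMul L₁ (Matrix.diagonal h)) L₂.transpose

namespace LUFactorization

/-- The polynomial `(S χ)_k = ∑_{j ≤ k} S_{k,j} x^j`, for a lower triangular matrix `S` and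
`χ = (1, x, x², …)ᵀ`. -/
noncomputable def rowPoly (S : Matrix ℕ ℕ ℝ) (k : ℕ) : ℝ[X] :=
  ∑ j ∈ Finset.range (k + 1), C (S k j) * X ^ j

/-- The first monic sequence `P₁ = S₁ χ` of the factorization. -/
noncomputable def P₁ {G : Matrix ℕ ℕ ℝ} (F : LUFactorization G) (k : ℕ) : ℝ[X] :=
  rowPoly F.S₁ k

/-- The second monic sequence `P₂ = S₂ χ` of the factorization. -/
noncomputable def P₂ {G : Matrix ℕ ℕ ℝ} (F : LUFactorization G) (k : ℕ) : ℝ[X] :=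
  rowPoly F.S₂ k

end LUFactorization

/-! The classical weights satisfy `u_{γ+1} = σ u_γ` and the Pearson equation `(σ u_γ)' = τ u_γ`,
with `deg σ ≤ 2` and `deg τ ≤ 1`. Integration by parts, with vanishing boundary terms
(`integral_pearson`), gives `⟨p', q⟩_{γ+1} = -⟨p, q'σ + qτ⟩_γ`, where `q'σ + qτ` has degree at most
`deg q + 1` (`bilin_succ_derivative`, `degree_pearson_lt`).

Hence the derivative of the classical `P_k` is orthogonal for `u_{γ+1}` to all degrees below `k -
1`. Both terms of `(P_k, x^j)` then vanish for `j < k`, so `P_k` is also the monic Sobolev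
orthogonal polynomial. Moreover `P_k' = k P_{γ+1,k-1}` by uniqueness, which yields the norm.

The link with matrices is purely algebraic. For a symmetric positive definite form, the rows of the
triangular factors of any LU factorization are the coefficients of the unique monic orthogonal
polynomials, and `h k = b(P_k, P_k)`. Conversely, these polynomials produce a factorization. -/

/-! ### Triangular matrices and their row polynomials -/

theorem LUFactorization.factor_apply {G : Matrix ℕ ℕ ℝ} {L₁ L₂ : Matrix ℕ ℕ ℝ} {h : ℕ → ℝ}
    (hG : G = lowerMul (lowerMul L₁ (Matrix.diagonal h)) L₂.transpose) (i j : ℕ) :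
    G i j = ∑ m ∈ Finset.range (i + 1), L₁ i m * h m * L₂ j m := by
  subst hG
  simp only [lowerMul, Matrix.of_apply, Matrix.transpose_apply]
  refine Finset.sum_congr rfl fun m hm => ?_
  congr 1
  rw [Finset.sum_eq_single m]
  · simp
  · intro b _ hb
    simp [Matrix.diagonal_apply_ne _ hb]
  · exact fun h => absurd hm h

/-- Sums from `lowerMul` stop at the row index of the left factor; this brings them to a common
range so that they can be compared or interchanged. -/
theorem IsLowerUnitriangular.sum_range_eq {L : Matrix ℕ ℕ ℝ} (hL : IsLowerUnitriangular L)
    (f : ℕ → ℝ) {i n : ℕ} (hin : i ≤ n) :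
    ∑ m ∈ Finset.range (i + 1), L i m * f m = ∑ m ∈ Finset.range (n + 1), L i m * f m := by
  refine Finset.sum_subset (Finset.range_mono (by omega)) fun m _ hm => ?_
  rw [hL.1 i m (by simpa using hm), zero_mul]

/-- The factorization with the two triangular factors exchanged, for a symmetric matrix. -/
def LUFactorization.swap {G : Matrix ℕ ℕ ℝ} (F : LUFactorization G)
    (hG : ∀ i j, G i j = G j i) : LUFactorization G where
  S₁ := F.S₂
  S₂ := F.S₁
  h := F.h
  lower₁ := F.lower₂
  lower₂ := F.lower₁
  factor := by
    obtain ⟨L₁, L₂, h₁, h₂, hF⟩ := F.factor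
    refine ⟨L₂, L₁, h₂, h₁, ?_⟩
    ext i j
    rw [hG, LUFactorization.factor_apply hF, LUFactorization.factor_apply rfl]
    have e₁ := h₁.1.sum_range_eq (fun m => F.h m * L₂ i m) (le_max_right i j)
    have e₂ := h₂.1.sum_range_eq (fun m => F.h m * L₁ j m) (le_max_left i j)
    simp only [← mul_assoc] at e₁ e₂
    rw [e₁, e₂]
    exact Finset.sum_congr rfl fun m _ => by ring

theorem LUFactorization.rowPoly_coeff {S : Matrix ℕ ℕ ℝ} (hS : IsLowerUnitriangular S)
    (k j : ℕ) : (rowPoly S k).coeff j = S k j := by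
  simp only [rowPoly, finsetSum_coeff, coeff_C_mul, coeff_X_pow, mul_ite, mul_one, mul_zero,
    Finset.sum_ite_eq, Finset.mem_range]
  split_ifs with h
  · rfl
  · exact (hS.1 k j (by omega)).symm

theorem LUFactorization.rowPoly_monic {S : Matrix ℕ ℕ ℝ} (hS : IsLowerUnitriangular S)
    (k : ℕ) : (rowPoly S k).Monic ∧ (rowPoly S k).natDegree = k := by
  have hle : (rowPoly S k).natDegree ≤ k := by
    refine natDegree_le_iff_coeff_eq_zero.2 fun j hj => ?_
    rw [rowPoly_coeff hS, hS.1 k j hj]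
  have hc : (rowPoly S k).coeff k = 1 := by rw [rowPoly_coeff hS, hS.2]
  exact ⟨monic_of_natDegree_le_of_coeff_eq_one k hle hc,
    le_antisymm hle (le_natDegree_of_ne_zero (by simp [hc]))⟩

/-! ### Monic orthogonal polynomials of a bilinear form -/

/-- `P` is a monic polynomial of degree `k`, orthogonal to all polynomials of lower degree. -/
structure IsMonicOrthogonal (b : LinearMap.BilinForm ℝ ℝ[X]) (k : ℕ) (P : ℝ[X]) : Prop where
  monic : P.Monic
  natDegree_eq : P.natDegree = k
  orthogonal : ∀ q : ℝ[X], q.degree < k → b P q = 0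

theorem LinearMap.BilinForm.apply_eq_sum (b : LinearMap.BilinForm ℝ ℝ[X]) (p q : ℝ[X]) {n : ℕ}
    (hq : q.degree < n) : b p q = ∑ j ∈ Finset.range n, q.coeff j * b p (X ^ j) := by
  rcases eq_or_ne q 0 with rfl | h
  · simp
  conv_lhs => rw [as_sum_range' q n ((natDegree_lt_iff_degree_lt h).2 hq)]
  rw [map_sum]
  refine Finset.sum_congr rfl fun j _ => ?_
  rw [← C_mul_X_pow_eq_monomial, ← smul_eq_C_mul, map_smul, smul_eq_mul]

theorem IsMonicOrthogonal.of_pow {b : LinearMap.BilinForm ℝ ℝ[X]} {k : ℕ} {P : ℝ[X]}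
    (hm : P.Monic) (hd : P.natDegree = k) (h : ∀ j < k, b P (X ^ j) = 0) :
    IsMonicOrthogonal b k P where
  monic := hm
  natDegree_eq := hd
  orthogonal q hq := by
    rw [b.apply_eq_sum P q hq]
    exact Finset.sum_eq_zero fun j hj => by rw [h j (by simpa using hj), mul_zero]

theorem IsMonicOrthogonal.degree_eq {b : LinearMap.BilinForm ℝ ℝ[X]} {k : ℕ} {P : ℝ[X]}
    (hP : IsMonicOrthogonal b k P) : P.degree = k := by
  rw [degree_eq_natDegree hP.monic.ne_zero, hP.natDegree_eq]

theorem IsMonicOrthogonal.degree_sub_lt {b c : LinearMap.BilinForm ℝ ℝ[X]} {k : ℕ} {P Q : ℝ[X]}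
    (hP : IsMonicOrthogonal b k P) (hQ : IsMonicOrthogonal c k Q) : (P - Q).degree < k := by
  rw [← hP.degree_eq]
  exact Polynomial.degree_sub_lt_left (hP.degree_eq.trans hQ.degree_eq.symm) hP.monic.ne_zero
    (hP.monic.leadingCoeff.trans hQ.monic.leadingCoeff.symm)

/-- The leading terms cancel in `P - Q`, so `P - Q` is orthogonal to itself. -/
theorem IsMonicOrthogonal.unique {b : LinearMap.BilinForm ℝ ℝ[X]}
    (hpos : ∀ p, p ≠ 0 → 0 < b p p) {k : ℕ} {P Q : ℝ[X]}
    (hP : IsMonicOrthogonal b k P) (hQ : IsMonicOrthogonal b k Q) : P = Q := by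
  by_contra hne
  have h := hpos _ (sub_ne_zero.2 hne)
  have hlt := hP.degree_sub_lt hQ
  rw [LinearMap.map_sub₂, hP.orthogonal _ hlt, hQ.orthogonal _ hlt, sub_zero] at h
  exact lt_irrefl _ h

theorem IsMonicOrthogonal.apply_X_pow {b : LinearMap.BilinForm ℝ ℝ[X]} {k : ℕ} {P : ℝ[X]}
    (hP : IsMonicOrthogonal b k P) : b P (X ^ k) = b P P := by
  have hX : (X ^ k - P).degree < (k : WithBot ℕ) := by
    have := Polynomial.degree_sub_lt_left (p := X ^ k) (q := P) (by rw [hP.degree_eq]; simp)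
      (by simp) (by simp [hP.monic.leadingCoeff])
    simpa using this
  have := hP.orthogonal _ hX
  rwa [map_sub, sub_eq_zero] at this

theorem IsMonicOrthogonal.apply_ne {b : LinearMap.BilinForm ℝ ℝ[X]}
    (hsymm : ∀ p q, b p q = b q p) {r k : ℕ} {P Q : ℝ[X]}
    (hP : IsMonicOrthogonal b r P) (hQ : IsMonicOrthogonal b k Q) (hrk : r ≠ k) : b P Q = 0 := by
  rcases hrk.lt_or_gt with h | h
  · rw [hsymm]
    exact hQ.orthogonal _ (by rw [hP.degree_eq]; exact_mod_cast h)
  · exact hP.orthogonal _ (by rw [hQ.degree_eq]; exact_mod_cast h)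

/-! ### Orthogonality from an LU factorization -/

namespace LUFactorization

variable {G : Matrix ℕ ℕ ℝ} {b : LinearMap.BilinForm ℝ ℝ[X]}

/-- This reads off row `r` of `S₁ G = H L₂ᵀ`: its entry `j` is `b (P₁ r) (X ^ j) = h r * L₂ j r`,
and `L₂` is lower unitriangular. -/
theorem apply_P₁_X_pow (F : LUFactorization G) (hG : ∀ i j, G i j = b (X ^ i) (X ^ j)) (r j : ℕ) :
    (j < r → b (F.P₁ r) (X ^ j) = 0) ∧ b (F.P₁ r) (X ^ r) = F.h r := by
  obtain ⟨L₁, L₂, h₁, h₂, hF⟩ := F.factor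
  have key : ∀ j, b (F.P₁ r) (X ^ j) = F.h r * L₂ j r := by
    intro j
    have e : b (F.P₁ r) (X ^ j) = ∑ i ∈ Finset.range (r + 1), F.S₁ r i *
        ∑ m ∈ Finset.range (r + 1), L₁ i m * (F.h m * L₂ j m) := by
      simp only [P₁, rowPoly, LinearMap.map_sum₂]
      refine Finset.sum_congr rfl fun i hi => ?_
      rw [← smul_eq_C_mul, LinearMap.map_smul₂, smul_eq_mul, ← hG, factor_apply hF,
        ← h₁.1.sum_range_eq _ (Nat.lt_succ_iff.1 (Finset.mem_range.1 hi))]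
      simp only [mul_assoc]
    have e' : ∀ m, ∑ i ∈ Finset.range (r + 1), F.S₁ r i * L₁ i m
        = (1 : Matrix ℕ ℕ ℝ) r m := fun m => congrFun (congrFun h₁.2.1 r) m
    rw [e]
    simp only [Finset.mul_sum]
    rw [Finset.sum_comm]
    simp only [← mul_assoc, ← Finset.sum_mul, e']
    rw [Finset.sum_eq_single r]
    · simp
    · intro m _ hm
      simp [Matrix.one_apply_ne hm.symm]
    · simp
  refine ⟨fun hj => ?_, ?_⟩
  · rw [key, h₂.1.1 j r hj, mul_zero]
  · rw [key, h₂.1.2, mul_one]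

theorem isMonicOrthogonal_P₁ (F : LUFactorization G) (hG : ∀ i j, G i j = b (X ^ i) (X ^ j))
    (k : ℕ) : IsMonicOrthogonal b k (F.P₁ k) :=
  .of_pow (rowPoly_monic F.lower₁ k).1 (rowPoly_monic F.lower₁ k).2
    fun j hj => (F.apply_P₁_X_pow hG k j).1 hj

theorem apply_P₁_self (F : LUFactorization G) (hG : ∀ i j, G i j = b (X ^ i) (X ^ j))
    (k : ℕ) : b (F.P₁ k) (F.P₁ k) = F.h k := by
  rw [← (F.isMonicOrthogonal_P₁ hG k).apply_X_pow, (F.apply_P₁_X_pow hG k k).2]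

theorem isMonicOrthogonal_P₂ (F : LUFactorization G) (hG : ∀ i j, G i j = b (X ^ i) (X ^ j))
    (hsymm : ∀ p q, b p q = b q p) (k : ℕ) : IsMonicOrthogonal b k (F.P₂ k) :=
  (F.swap fun i j => by rw [hG, hG, hsymm]).isMonicOrthogonal_P₁ hG k

end LUFactorization

/-! ### Existence of orthogonal polynomials and of the factorization -/

/-- A kernel vector of a truncation is the coefficient vector of a nonzero `p` with `b p p = 0`. -/
theorem admitsLU_of_posDef {G : Matrix ℕ ℕ ℝ} {b : LinearMap.BilinForm ℝ ℝ[X]}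
    (hG : ∀ i j, G i j = b (X ^ i) (X ^ j)) (hpos : ∀ p, p ≠ 0 → 0 < b p p) : AdmitsLU G := by
  intro k hdet
  obtain ⟨v, hv, hGv⟩ := Matrix.exists_mulVec_eq_zero_iff.2 hdet
  set p : ℝ[X] := ∑ i : Fin k, C (v i) * X ^ (i : ℕ) with hp
  have hp0 : p ≠ 0 := by
    intro h0
    refine hv (funext fun i => ?_)
    have := congrArg (fun q : ℝ[X] => q.coeff i) h0
    simpa [hp, finsetSum_coeff, coeff_X_pow, Fin.val_inj] using this
  have key : ∀ i : Fin k, b (X ^ (i : ℕ)) p = 0 := by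
    intro i
    have := congrFun hGv i
    simp only [Matrix.mulVec, dotProduct, truncation, Matrix.submatrix_apply, hG,
      Pi.zero_apply] at this
    rw [← this, hp, map_sum]
    refine Finset.sum_congr rfl fun j _ => ?_
    rw [← smul_eq_C_mul, map_smul, smul_eq_mul, mul_comm]
  have h0 : b p p = 0 := by
    conv_lhs => rw [hp, LinearMap.map_sum₂]
    refine Finset.sum_eq_zero fun i _ => ?_
    rw [← smul_eq_C_mul, LinearMap.map_smul₂, ← hp, key, smul_zero]
  exact (hpos p hp0).ne' h0

/-- The lower coefficients solve a linear system whose matrix is the invertible truncation of size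
`k`. -/
theorem exists_isMonicOrthogonal {b : LinearMap.BilinForm ℝ ℝ[X]}
    (hsymm : ∀ p q, b p q = b q p) (hpos : ∀ p, p ≠ 0 → 0 < b p p) (k : ℕ) :
    ∃ P, IsMonicOrthogonal b k P := by
  set G : Matrix ℕ ℕ ℝ := Matrix.of fun i j => b (X ^ i) (X ^ j)
  have hdet := admitsLU_of_posDef (G := G) (fun _ _ => rfl) hpos k
  set c : Fin k → ℝ := (truncation G k)⁻¹.mulVec fun i : Fin k => - b (X ^ (i : ℕ)) (X ^ k) with hc
  have hGc : (truncation G k).mulVec c = fun i : Fin k => - b (X ^ (i : ℕ)) (X ^ k) := by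
    rw [hc, Matrix.mulVec_mulVec, Matrix.mul_nonsing_inv _ (isUnit_iff_ne_zero.2 hdet),
      Matrix.one_mulVec]
  set q : ℝ[X] := ∑ i : Fin k, C (c i) * X ^ (i : ℕ) with hq
  have hqd : q.degree < k := by
    refine (degree_sum_le _ _).trans_lt ((Finset.sup_lt_iff (by simp)).2 fun i _ => ?_)
    exact (degree_C_mul_X_pow_le _ _).trans_lt (by exact_mod_cast i.2)
  refine ⟨X ^ k + q, .of_pow (monic_X_pow_add hqd) ?_ fun j hj => ?_⟩
  · rw [natDegree_add_eq_left_of_degree_lt (by simpa using hqd), natDegree_X_pow]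
  · have := congrFun hGc ⟨j, hj⟩
    simp only [Matrix.mulVec, dotProduct, truncation, Matrix.submatrix_apply, G,
      Matrix.of_apply] at this
    rw [hsymm, map_add, hq, map_sum, ← eq_neg_iff_add_eq_zero, ← neg_eq_iff_eq_neg, ← this]
    refine Finset.sum_congr rfl fun i _ => ?_
    rw [← smul_eq_C_mul, map_smul, smul_eq_mul, mul_comm]

/-- `S` holds the coefficients of the `P k`, and `L` the Fourier coefficients of the monomials in
the basis `P k`. These changes of basis are mutually inverse, and expanding the first argument of `b
(X ^ i) (X ^ j)` gives the factorization. -/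
theorem nonempty_lUFactorization {G : Matrix ℕ ℕ ℝ} {b : LinearMap.BilinForm ℝ ℝ[X]}
    (hG : ∀ i j, G i j = b (X ^ i) (X ^ j))
    (hsymm : ∀ p q, b p q = b q p) (hpos : ∀ p, p ≠ 0 → 0 < b p p) :
    Nonempty (LUFactorization G) := by
  choose P hP using exists_isMonicOrthogonal hsymm hpos
  set h : ℕ → ℝ := fun k => b (P k) (P k) with hh
  have h0 : ∀ k, h k ≠ 0 := fun k => (hpos _ (hP k).monic.ne_zero).ne'
  set S : Matrix ℕ ℕ ℝ := Matrix.of fun k j => (P k).coeff j with hS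
  set L : Matrix ℕ ℕ ℝ := Matrix.of fun i k => b (P k) (X ^ i) / h k with hL
  have lS : IsLowerUnitriangular S := by
    refine ⟨fun i j hij => coeff_eq_zero_of_natDegree_lt (by rwa [(hP i).natDegree_eq]),
      fun i => ?_⟩
    have := (hP i).monic.coeff_natDegree
    rwa [(hP i).natDegree_eq] at this
  have lL : IsLowerUnitriangular L := by
    refine ⟨fun i j hij => ?_, fun i => ?_⟩
    · simp only [hL, Matrix.of_apply]
      rw [(hP j).orthogonal _ (by rw [degree_X_pow]; exact_mod_cast hij), zero_div]
    · simp only [hL, Matrix.of_apply]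
      rw [(hP i).apply_X_pow, div_self (h0 i)]
  have expand : ∀ i, X ^ i = ∑ k ∈ Finset.range (i + 1), L i k • P k := by
    intro i
    set q := X ^ i - ∑ k ∈ Finset.range (i + 1), L i k • P k with hq
    have hPq : ∀ m ≤ i, b (P m) q = 0 := by
      intro m hm
      rw [hq, map_sub, map_sum, Finset.sum_eq_single m]
      · rw [map_smul, smul_eq_mul]
        simp only [hL, Matrix.of_apply]
        change b (P m) (X ^ i) - b (P m) (X ^ i) / h m * h m = 0
        rw [div_mul_cancel₀ _ (h0 m), sub_self]
      · intro k _ hk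
        rw [map_smul, (hP m).apply_ne hsymm (hP k) hk.symm, smul_zero]
      · intro hm'
        exact absurd (Finset.mem_range.2 (by omega)) hm'
    have hqd : q.natDegree ≤ i := by
      refine (natDegree_sub_le _ _).trans (max_le (natDegree_X_pow_le i) ?_)
      refine natDegree_sum_le_of_forall_le _ _ fun k hk => ?_
      refine (natDegree_smul_le _ _).trans ?_
      rw [(hP k).natDegree_eq]
      exact Nat.lt_succ_iff.1 (Finset.mem_range.1 hk)
    by_contra hne
    have hq0 : q ≠ 0 := sub_ne_zero.2 hne
    -- The remainder `q` is orthogonal to `P m` for its own degree `m ≤ i`. Yet `q` is its leading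
    -- coefficient times `P m` plus lower terms, so that pairing is the leading coefficient times `h
    -- m`, which is nonzero.
    set m := q.natDegree with hm
    have hlt : (q - C q.leadingCoeff * P m).degree < m := by
      have := Polynomial.degree_sub_lt_left (p := q) (q := C q.leadingCoeff * P m)
        (by rw [degree_C_mul (leadingCoeff_ne_zero.2 hq0), (hP m).degree_eq,
          degree_eq_natDegree hq0]) hq0 (by simp [(hP m).monic.leadingCoeff])
      rwa [degree_eq_natDegree hq0] at this
    have e := (hP m).orthogonal _ hlt
    rw [map_sub, hPq m hqd, ← smul_eq_C_mul, map_smul, zero_sub, neg_eq_zero, smul_eq_mul] at e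
    exact mul_ne_zero (leadingCoeff_ne_zero.2 hq0) (h0 m) e
  have expandP : ∀ k, P k = ∑ j ∈ Finset.range (k + 1), S k j • X ^ j := by
    intro k
    conv_lhs => rw [as_sum_range' (P k) (k + 1) (by rw [(hP k).natDegree_eq]; omega)]
    exact Finset.sum_congr rfl fun j _ => by
      rw [← C_mul_X_pow_eq_monomial, ← smul_eq_C_mul]; rfl
  have hSL : lowerMul S L = 1 := by
    ext k i
    have : lowerMul S L k i = b (P i) (P k) / h i := by
      conv_rhs => rw [expandP k, map_sum, Finset.sum_div]
      simp only [map_smul, smul_eq_mul, mul_div_assoc]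
      rfl
    rw [this]
    rcases eq_or_ne k i with rfl | hki
    · rw [Matrix.one_apply_eq]; exact div_self (h0 k)
    · rw [Matrix.one_apply_ne hki, (hP i).apply_ne hsymm (hP k) hki.symm, zero_div]
  have hLS : lowerMul L S = 1 := by
    ext i j
    have := congrArg (fun q : ℝ[X] => q.coeff j) (expand i)
    simp only [finsetSum_coeff, coeff_smul, smul_eq_mul, coeff_X_pow] at this
    rw [Matrix.one_apply]
    simp only [eq_comm (a := i)]
    exact this.symm
  refine ⟨⟨S, S, h, lS, lS, L, L, ⟨lL, hSL, hLS⟩, ⟨lL, hSL, hLS⟩, ?_⟩⟩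
  ext i j
  rw [LUFactorization.factor_apply rfl, hG]
  conv_lhs => rw [expand i, LinearMap.map_sum₂]
  refine Finset.sum_congr rfl fun m _ => ?_
  rw [LinearMap.map_smul₂, smul_eq_mul, mul_assoc]
  congr 1
  simp only [hL, Matrix.of_apply]
  rw [mul_div_cancel₀ _ (h0 m)]

/-! ### Integrability and positivity of the classical weights -/

namespace ClassicalParam

theorem Admissible.succ {γ : ClassicalParam} (hγ : γ.Admissible) : γ.succ.Admissible := by
  cases γ with
  | hermite => trivial
  | laguerre α => simp only [Admissible, ClassicalParam.succ] at *; linarith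
  | jacobi α β =>
    simp only [Admissible, ClassicalParam.succ] at *
    exact ⟨by linarith [hγ.1], by linarith [hγ.2]⟩

theorem domain_succ (γ : ClassicalParam) : γ.succ.domain = γ.domain := by
  cases γ <;> rfl

theorem isOpen_domain (γ : ClassicalParam) : IsOpen γ.domain := by
  cases γ
  · exact isOpen_univ
  · exact isOpen_Ioi
  · exact isOpen_Ioo

theorem nonempty_domain (γ : ClassicalParam) : γ.domain.Nonempty := by
  cases γ
  · exact ⟨0, trivial⟩
  · exact ⟨1, one_pos (α := ℝ)⟩
  · exact ⟨0, by norm_num, by norm_num⟩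

theorem weight_pos (γ : ClassicalParam) {x : ℝ} (hx : x ∈ γ.domain) : 0 < γ.weight x := by
  cases γ with
  | hermite => exact Real.exp_pos _
  | laguerre α => exact mul_pos (Real.rpow_pos_of_pos hx _) (Real.exp_pos _)
  | jacobi α β =>
    exact mul_pos (Real.rpow_pos_of_pos (by linarith [hx.2]) _)
      (Real.rpow_pos_of_pos (by linarith [hx.1]) _)

/-- Splitting at `0` leaves one possibly singular factor on each half; the other is continuous
there. -/
theorem integrableOn_jacobi_weight {α β : ℝ} (hα : -1 < α) (hβ : -1 < β) :
    IntegrableOn (jacobi α β).weight (Set.Ioo (-1) 1) := by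
  have hl : IntervalIntegrable (fun x : ℝ => (1 - x) ^ α * (1 + x) ^ β) volume (-1) 0 := by
    refine IntervalIntegrable.continuousOn_mul ?_ ?_
    · simpa [add_comm] using
        (intervalIntegral.intervalIntegrable_rpow' (a := 0) (b := 1) hβ).comp_add_right 1
    · refine ContinuousOn.rpow_const (by fun_prop) fun x hx => Or.inl ?_
      rw [Set.uIcc_of_le (by norm_num)] at hx
      linarith [hx.2]
  have hr : IntervalIntegrable (fun x : ℝ => (1 - x) ^ α * (1 + x) ^ β) volume 0 1 := by
    refine IntervalIntegrable.mul_continuousOn ?_ ?_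
    · simpa using
        (intervalIntegral.intervalIntegrable_rpow' (a := 1) (b := 0) hα).comp_sub_left 1
    · refine ContinuousOn.rpow_const (by fun_prop) fun x hx => Or.inl ?_
      rw [Set.uIcc_of_le (by norm_num)] at hx
      linarith [hx.1]
  exact ((intervalIntegrable_iff_integrableOn_Ioc_of_le (by norm_num)).1 (hl.trans hr)).mono_set
    Set.Ioo_subset_Ioc_self

theorem integrableOn_pow_mul_weight {γ : ClassicalParam} (hγ : γ.Admissible) (n : ℕ) :
    IntegrableOn (fun x => x ^ n * γ.weight x) γ.domain := by
  cases γ with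
  | hermite =>
    have h := integrable_rpow_mul_exp_neg_mul_sq (b := 1) one_pos (s := n)
      (by linarith [n.cast_nonneg (α := ℝ)])
    simp only [Real.rpow_natCast, neg_mul, one_mul] at h
    exact h.integrableOn
  | laguerre α =>
    simp only [Admissible] at hγ
    have h := Real.GammaIntegral_convergent (s := n + α + 1)
      (by linarith [n.cast_nonneg (α := ℝ)])
    refine h.congr_fun (fun x (hx : 0 < x) => ?_) measurableSet_Ioi
    simp only [weight, add_sub_cancel_right]
    rw [Real.rpow_add hx, Real.rpow_natCast]
    ring
  | jacobi α β =>
    have h := integrableOn_jacobi_weight hγ.1 hγ.2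
    refine Integrable.bdd_mul h (c := 1) (by fun_prop) ?_
    refine (ae_restrict_iff' measurableSet_Ioo).2 (Filter.Eventually.of_forall fun x hx => ?_)
    rw [norm_pow]
    exact pow_le_one₀ (norm_nonneg _) (abs_le.2 ⟨hx.1.le, hx.2.le⟩)

theorem integrableOn_eval_mul_weight {γ : ClassicalParam} (hγ : γ.Admissible) (p : ℝ[X]) :
    IntegrableOn (fun x => p.eval x * γ.weight x) γ.domain := by
  simp only [eval_eq_sum_range, Finset.sum_mul, mul_assoc]
  exact integrable_finsetSum _ fun i _ => (integrableOn_pow_mul_weight hγ i).const_mul _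

/-- The integrand is positive off the finite, hence null, root set of `p`. -/
theorem integral_sq_mul_weight_pos {γ : ClassicalParam} (hγ : γ.Admissible) {p : ℝ[X]}
    (hp : p ≠ 0) : 0 < ∫ x in γ.domain, (p * p).eval x * γ.weight x := by
  rw [setIntegral_pos_iff_support_of_nonneg_ae ?_ (integrableOn_eval_mul_weight hγ _)]
  · have hsub : γ.domain \ {x | p.IsRoot x} ⊆
        (Function.support fun x => (p * p).eval x * γ.weight x) ∩ γ.domain := by
      rintro x ⟨hx, hr⟩
      refine ⟨?_, hx⟩
      rw [Function.mem_support, eval_mul]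
      exact mul_ne_zero (mul_ne_zero hr hr) (γ.weight_pos hx).ne'
    refine lt_of_lt_of_le ?_ (measure_mono hsub)
    rw [measure_sdiff_null ((finite_setOfPred_isRoot hp).measure_zero _)]
    exact γ.isOpen_domain.measure_pos _ γ.nonempty_domain
  · refine (ae_restrict_iff' γ.isOpen_domain.measurableSet).2
      (Filter.Eventually.of_forall fun x hx => ?_)
    simp only [Pi.zero_apply, eval_mul]
    exact mul_nonneg (mul_self_nonneg _) (γ.weight_pos hx).le

/-! ### The Pearson equation and integration by parts -/

/-- The polynomial `σ` with `u_{γ+1} = σ u_γ`. -/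
noncomputable def sigma : ClassicalParam → ℝ[X]
  | hermite => 1
  | laguerre _ => X
  | jacobi _ _ => 1 - X ^ 2

/-- The polynomial `τ` of the Pearson equation `(σ u_γ)' = τ u_γ`. -/
noncomputable def tau : ClassicalParam → ℝ[X]
  | hermite => C (-2) * X
  | laguerre α => C (α + 1) - X
  | jacobi α β => C (β - α) - C (α + β + 2) * X

theorem natDegree_sigma_le (γ : ClassicalParam) : γ.sigma.natDegree ≤ 2 := by
  cases γ <;> simp only [sigma] <;> compute_degree <;> norm_num

theorem natDegree_tau_le (γ : ClassicalParam) : γ.tau.natDegree ≤ 1 := by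
  cases γ <;> simp only [tau] <;> compute_degree

theorem weight_succ (γ : ClassicalParam) {x : ℝ} (hx : x ∈ γ.domain) :
    γ.succ.weight x = γ.sigma.eval x * γ.weight x := by
  cases γ with
  | hermite => simp [succ, sigma]
  | laguerre α =>
    simp only [succ, sigma, weight, eval_X]
    rw [Real.rpow_add_one (ne_of_gt hx)]
    ring
  | jacobi α β =>
    simp only [succ, sigma, weight, eval_sub, eval_one, eval_pow, eval_X]
    rw [Real.rpow_add_one (by linarith [hx.2]), Real.rpow_add_one (by linarith [hx.1])]
    ring

theorem hasDerivAt_weight_succ (γ : ClassicalParam) {x : ℝ} (hx : x ∈ γ.domain) :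
    HasDerivAt γ.succ.weight (γ.tau.eval x * γ.weight x) x := by
  cases γ with
  | hermite =>
    have h := ((hasDerivAt_pow 2 x).neg).exp
    refine h.congr_deriv ?_
    simp [tau, weight]
    ring
  | laguerre α =>
    have hx0 : x ≠ 0 := ne_of_gt hx
    have h := ((hasDerivAt_id x).rpow_const (p := α + 1) (Or.inl hx0)).mul (hasDerivAt_neg x).exp
    refine h.congr_deriv ?_
    simp only [tau, weight, eval_sub, eval_C, eval_X, id, add_sub_cancel_right]
    rw [Real.rpow_add_one hx0]
    ring
  | jacobi α β =>
    have h₁ : 1 - x ≠ 0 := by linarith [hx.2]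
    have h₂ : 1 + x ≠ 0 := by linarith [hx.1]
    have h := (((hasDerivAt_id x).const_sub 1).rpow_const (p := α + 1) (Or.inl h₁)).mul
      (((hasDerivAt_id x).const_add 1).rpow_const (p := β + 1) (Or.inl h₂))
    refine h.congr_deriv ?_
    simp only [tau, weight, eval_sub, eval_mul, eval_C, eval_X, id, add_sub_cancel_right]
    rw [Real.rpow_add_one h₁, Real.rpow_add_one h₂]
    ring

theorem hasDerivAt_eval_mul_weight_succ (γ : ClassicalParam) (p : ℝ[X]) {x : ℝ}
    (hx : x ∈ γ.domain) : HasDerivAt (fun y => p.eval y * γ.succ.weight y)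
      ((derivative p * γ.sigma + p * γ.tau).eval x * γ.weight x) x := by
  refine ((p.hasDerivAt x).mul (γ.hasDerivAt_weight_succ hx)).congr_deriv ?_
  rw [γ.weight_succ hx, eval_add, eval_mul, eval_mul]
  ring

/-- The integrand is the derivative of `p u_{γ+1}`. This product vanishes at finite endpoints
because the shifted exponents are positive, and at infinity because it and its derivative are
integrable. -/
theorem integral_pearson {γ : ClassicalParam} (hγ : γ.Admissible) (p : ℝ[X]) :
    ∫ x in γ.domain, (derivative p * γ.sigma + p * γ.tau).eval x * γ.weight x = 0 := by
  have hi := integrableOn_eval_mul_weight hγ (derivative p * γ.sigma + p * γ.tau)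
  have hi' := integrableOn_eval_mul_weight hγ.succ p
  have hd : ∀ x ∈ γ.domain, _ := fun x hx => γ.hasDerivAt_eval_mul_weight_succ p hx
  rw [domain_succ] at hi'
  cases γ with
  | hermite =>
    simp only [domain, integrableOn_univ, Set.mem_univ, forall_true_left,
      Measure.restrict_univ] at *
    exact integral_eq_zero_of_hasDerivAt_of_integrable hd hi hi'
  | laguerre α =>
    simp only [Admissible] at hγ
    have h0 : ContinuousWithinAt (fun y => p.eval y * (laguerre α).succ.weight y)
        (Set.Ici 0) 0 := by
      refine ContinuousAt.continuousWithinAt ?_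
      simp only [succ, weight]
      refine p.continuous.continuousAt.mul (ContinuousAt.mul ?_ (by fun_prop))
      exact Real.continuousAt_rpow_const _ _ (Or.inr (by linarith))
    have := integral_Ioi_of_hasDerivAt_of_tendsto h0 hd hi
      (tendsto_zero_of_hasDerivAt_of_integrableOn_Ioi hd hi hi')
    refine this.trans ?_
    simp [succ, weight, Real.zero_rpow (show α + 1 ≠ 0 by linarith)]
  | jacobi α β =>
    obtain ⟨h₁, h₂⟩ := hγ
    have hc : ContinuousOn (fun y => p.eval y * (jacobi α β).succ.weight y)
        (Set.Icc (-1) 1) := by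
      simp only [succ, weight]
      refine p.continuous.continuousOn.mul (ContinuousOn.mul ?_ ?_)
      · exact ContinuousOn.rpow_const (by fun_prop) fun x _ => Or.inr (by linarith)
      · exact ContinuousOn.rpow_const (by fun_prop) fun x _ => Or.inr (by linarith)
    have := intervalIntegral.integral_eq_sub_of_hasDerivAt_of_le (by norm_num) hc hd
      ((intervalIntegrable_iff_integrableOn_Ioo_of_le (by norm_num)).2 hi)
    rw [intervalIntegral.integral_of_le (by norm_num), integral_Ioc_eq_integral_Ioo] at this
    refine this.trans ?_
    simp [succ, weight, Real.zero_rpow (show α + 1 ≠ 0 by linarith),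
      Real.zero_rpow (show β + 1 ≠ 0 by linarith)]

/-! ### The two forms on polynomials -/

/-- The moment functional `p ↦ ∫ p u_γ`. -/
noncomputable def momentFunctional (γ : ClassicalParam) (hγ : γ.Admissible) : ℝ[X] →ₗ[ℝ] ℝ where
  toFun p := ∫ x in γ.domain, p.eval x * γ.weight x
  map_add' p q := by
    simp only [eval_add, add_mul]
    exact integral_add (integrableOn_eval_mul_weight hγ p) (integrableOn_eval_mul_weight hγ q)
  map_smul' c p := by
    simp only [eval_smul, smul_eq_mul, mul_assoc, RingHom.id_apply]
    exact integral_const_mul _ _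

/-- The form `⟨·, ·⟩_γ` on polynomials. -/
noncomputable def bilin (γ : ClassicalParam) (hγ : γ.Admissible) : LinearMap.BilinForm ℝ ℝ[X] :=
  (LinearMap.mul ℝ ℝ[X]).compr₂ (γ.momentFunctional hγ)

/-- The Sobolev form `(·, ·)` on polynomials. -/
noncomputable def sobolevBilin (γ : ClassicalParam) (hγ : γ.Admissible) (lam : ℝ) :
    LinearMap.BilinForm ℝ ℝ[X] :=
  γ.bilin hγ + lam • (γ.succ.bilin hγ.succ).compl₁₂ derivative derivative

variable {γ : ClassicalParam} (hγ : γ.Admissible)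

theorem bilin_apply (p q : ℝ[X]) : γ.bilin hγ p q = γ.momentFunctional hγ (p * q) := rfl

theorem sobolevBilin_apply (lam : ℝ) (p q : ℝ[X]) : γ.sobolevBilin hγ lam p q =
    γ.bilin hγ p q + lam * γ.succ.bilin hγ.succ (derivative p) (derivative q) := rfl

theorem form_eval (p q : ℝ[X]) :
    γ.form (fun x => p.eval x) (fun x => q.eval x) = γ.bilin hγ p q := by
  simp only [bilin_apply, momentFunctional, LinearMap.coe_mk, AddHom.coe_mk, form, eval_mul]

theorem sobolevForm_eval (lam : ℝ) (p q : ℝ[X]) :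
    γ.sobolevForm lam (fun x => p.eval x) (fun x => q.eval x) = γ.sobolevBilin hγ lam p q := by
  have hd : ∀ p : ℝ[X], deriv (fun x => p.eval x) = fun x => (derivative p).eval x :=
    fun p => funext fun x => p.deriv
  rw [sobolevForm, hd, hd, form_eval hγ, form_eval hγ.succ, sobolevBilin_apply]

theorem momentMatrix_form (i j : ℕ) :
    momentMatrix γ.form i j = γ.bilin hγ (X ^ i) (X ^ j) := by
  rw [← form_eval]
  simp [momentMatrix]

theorem momentMatrix_sobolevForm (lam : ℝ) (i j : ℕ) :
    momentMatrix (γ.sobolevForm lam) i j = γ.sobolevBilin hγ lam (X ^ i) (X ^ j) := by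
  rw [← sobolevForm_eval]
  simp [momentMatrix]

theorem bilin_symm (p q : ℝ[X]) : γ.bilin hγ p q = γ.bilin hγ q p := by
  rw [bilin_apply, bilin_apply, mul_comm]

theorem bilin_pos (p : ℝ[X]) (hp : p ≠ 0) : 0 < γ.bilin hγ p p :=
  integral_sq_mul_weight_pos hγ hp

theorem sobolevBilin_symm (lam : ℝ) (p q : ℝ[X]) :
    γ.sobolevBilin hγ lam p q = γ.sobolevBilin hγ lam q p := by
  rw [sobolevBilin_apply, sobolevBilin_apply, bilin_symm, bilin_symm hγ.succ]

theorem sobolevBilin_pos {lam : ℝ} (hlam : 0 < lam) (p : ℝ[X]) (hp : p ≠ 0) :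
    0 < γ.sobolevBilin hγ lam p p := by
  rw [sobolevBilin_apply]
  refine add_pos_of_pos_of_nonneg (bilin_pos hγ p hp) (mul_nonneg hlam.le ?_)
  rcases eq_or_ne (derivative p) 0 with h | h
  · simp [h]
  · exact (bilin_pos hγ.succ _ h).le

theorem bilin_succ_eq (p q : ℝ[X]) :
    γ.succ.bilin hγ.succ p q = γ.momentFunctional hγ (p * q * γ.sigma) := by
  change ∫ x in γ.succ.domain, _ = ∫ x in γ.domain, _
  rw [domain_succ]
  refine setIntegral_congr_fun γ.isOpen_domain.measurableSet fun x hx => ?_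
  simp only [γ.weight_succ hx, LinearMap.mul_apply', eval_mul, mul_assoc]

/-- The Pearson identity for the product `p * q`, expanded by the Leibniz rule. -/
theorem bilin_succ_derivative (p q : ℝ[X]) :
    γ.succ.bilin hγ.succ (derivative p) q =
      - γ.bilin hγ p (derivative q * γ.sigma + q * γ.tau) := by
  have h : γ.momentFunctional hγ (derivative (p * q) * γ.sigma + p * q * γ.tau) = 0 :=
    integral_pearson hγ (p * q)
  rw [bilin_succ_eq hγ, bilin_apply, eq_neg_iff_add_eq_zero, ← map_add, ← h, derivative_mul]
  congr 1
  ring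

theorem degree_pearson_lt {k : ℕ} {q : ℝ[X]} (hq : q.natDegree + 1 < k) :
    (derivative q * γ.sigma + q * γ.tau).degree < k := by
  have hσ := γ.natDegree_sigma_le
  have hτ := γ.natDegree_tau_le
  refine (degree_le_of_natDegree_le (n := q.natDegree + 1) ?_).trans_lt (by exact_mod_cast hq)
  refine natDegree_add_le_of_degree_le ?_ (natDegree_mul_le.trans (by omega))
  -- For constant `q` the derivative term vanishes; otherwise differentiation lowers the degree by
  -- at least one, which offsets part of the rise of at most two due to `σ`.
  rcases Nat.eq_zero_or_pos q.natDegree with h | h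
  · rw [derivative_of_natDegree_zero h]
    simp
  · exact natDegree_mul_le.trans (by have := natDegree_derivative_lt h.ne'; omega)

end ClassicalParam

/-! ### Sobolev orthogonality and norms -/

namespace IsMonicOrthogonal

open ClassicalParam

variable {γ : ClassicalParam} {hγ : γ.Admissible} {k : ℕ} {P : ℝ[X]}

theorem bilin_succ_derivative_eq_zero (hP : IsMonicOrthogonal (γ.bilin hγ) k P) {q : ℝ[X]}
    (hq : q.natDegree + 1 < k) : γ.succ.bilin hγ.succ (derivative P) q = 0 := by
  rw [bilin_succ_derivative hγ, hP.orthogonal _ (degree_pearson_lt hq), neg_zero]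

/-- The derivative of `X ^ j` has degree below `j`, so for `j < k` it lies within the range where
the derivative of `P` is orthogonal for `u_{γ+1}`. -/
theorem sobolev (hP : IsMonicOrthogonal (γ.bilin hγ) k P) (lam : ℝ) :
    IsMonicOrthogonal (γ.sobolevBilin hγ lam) k P := by
  refine .of_pow hP.monic hP.natDegree_eq fun j hj => ?_
  have h₁ : γ.bilin hγ P (X ^ j) = 0 :=
    hP.orthogonal _ (by rw [degree_X_pow]; exact_mod_cast hj)
  rw [sobolevBilin_apply, h₁, zero_add]
  rcases Nat.eq_zero_or_pos j with rfl | hj0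
  · simp
  · rw [hP.bilin_succ_derivative_eq_zero, mul_zero]
    have := natDegree_derivative_lt (p := (X ^ j : ℝ[X])) (by rw [natDegree_X_pow]; omega)
    rw [natDegree_X_pow] at this
    omega

/-- The derivatives of the monic orthogonal polynomials for `u_γ` are orthogonal for `u_{γ+1}`. -/
theorem derivative_eq (hP : IsMonicOrthogonal (γ.bilin hγ) (k + 1) P) {Q : ℝ[X]}
    (hQ : IsMonicOrthogonal (γ.succ.bilin hγ.succ) k Q) :
    derivative P = C ((k : ℝ) + 1) * Q := by
  have hk : (k : ℝ) + 1 ≠ 0 := by positivity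
  have hc : (C ((k : ℝ) + 1)⁻¹ * derivative P).coeff k = 1 := by
    have h := hP.monic.coeff_natDegree
    rw [hP.natDegree_eq] at h
    rw [coeff_C_mul, coeff_derivative, h, one_mul, inv_mul_cancel₀ hk]
  have hle : (C ((k : ℝ) + 1)⁻¹ * derivative P).natDegree ≤ k := by
    refine (natDegree_C_mul_le _ _).trans ((natDegree_derivative_le P).trans ?_)
    rw [hP.natDegree_eq, Nat.add_sub_cancel]
  have hD : IsMonicOrthogonal (γ.succ.bilin hγ.succ) k (C ((k : ℝ) + 1)⁻¹ * derivative P) := by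
    refine .of_pow (monic_of_natDegree_le_of_coeff_eq_one k hle hc)
      (le_antisymm hle (le_natDegree_of_ne_zero (by simp [hc]))) fun j hj => ?_
    rw [← smul_eq_C_mul, LinearMap.map_smul₂, hP.bilin_succ_derivative_eq_zero, smul_zero]
    rw [natDegree_X_pow]
    omega
  rw [← hD.unique (bilin_pos hγ.succ) hQ, ← mul_assoc, ← C_mul, mul_inv_cancel₀ hk, C_1, one_mul]

theorem sobolevBilin_self (hP : IsMonicOrthogonal (γ.bilin hγ) k P) {Q : ℝ[X]}
    (hQ : IsMonicOrthogonal (γ.succ.bilin hγ.succ) (k - 1) Q) (lam : ℝ) :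
    γ.sobolevBilin hγ lam P P =
      γ.bilin hγ P P + lam * (k : ℝ) ^ 2 * γ.succ.bilin hγ.succ Q Q := by
  rw [sobolevBilin_apply]
  -- For `k = 0` the index `k - 1` is truncated to `0`; the factor `k ^ 2` removes that term.
  rcases k with _ | k
  · rw [derivative_of_natDegree_zero hP.natDegree_eq]
    simp
  · rw [hP.derivative_eq hQ, ← smul_eq_C_mul, LinearMap.map_smul₂, map_smul]
    simp only [smul_eq_mul]
    push_cast
    ring

end IsMonicOrthogonal

/-- The Sobolev bi-orthogonal polynomials `P₁`, `P₂` and the norms `h` of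
`(f, h) = ∫ f h u_γ + lam ∫ f' h' u_{γ+1}`, in terms of the classical ones (for `k = 0` the term
with `k ^ 2` vanishes). -/
theorem mainTheorem11 (γ : ClassicalParam) (hγ : γ.Admissible) (lam : ℝ) (hlam : 0 < lam) :
    -- all the integrals that define the form on polynomials converge
    (∀ p : ℝ[X], IntegrableOn (fun x => p.eval x * γ.weight x) γ.domain ∧
      IntegrableOn (fun x => p.eval x * γ.succ.weight x) γ.succ.domain) ∧
    -- the Sobolev form is positive definite on polynomials
    (∀ p : ℝ[X], p ≠ 0 → 0 < γ.sobolevForm lam (fun x => p.eval x) (fun x => p.eval x)) ∧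
    -- the three moment matrices admit an LU factorization
    (AdmitsLU (momentMatrix γ.form) ∧ AdmitsLU (momentMatrix γ.succ.form) ∧
      AdmitsLU (momentMatrix (γ.sobolevForm lam))) ∧
    (Nonempty (LUFactorization (momentMatrix γ.form)) ∧
      Nonempty (LUFactorization (momentMatrix γ.succ.form)) ∧
      Nonempty (LUFactorization (momentMatrix (γ.sobolevForm lam)))) ∧
    -- the polynomials and norms that these factorizations define
    (∀ (F : LUFactorization (momentMatrix γ.form))
      (F' : LUFactorization (momentMatrix γ.succ.form))
      (Fs : LUFactorization (momentMatrix (γ.sobolevForm lam))),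
      (∀ k : ℕ, F.P₂ k = F.P₁ k ∧ Fs.P₁ k = F.P₁ k ∧ Fs.P₂ k = F.P₁ k ∧
        Fs.h k = F.h k + lam * (k : ℝ) ^ 2 * F'.h (k - 1)) ∧
      (∀ r k : ℕ, γ.form (fun x => (F.P₁ r).eval x) (fun x => (F.P₁ k).eval x) =
        if r = k then F.h k else 0) ∧
      (∀ r k : ℕ, γ.sobolevForm lam (fun x => (F.P₁ r).eval x) (fun x => (F.P₁ k).eval x) =
        if r = k then F.h k + lam * (k : ℝ) ^ 2 * F'.h (k - 1) else 0)) := by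

  have hG := ClassicalParam.momentMatrix_form hγ
  have hG' := ClassicalParam.momentMatrix_form hγ.succ
  have hGs := ClassicalParam.momentMatrix_sobolevForm hγ lam
  have hs := ClassicalParam.bilin_symm hγ
  have hp := ClassicalParam.bilin_pos hγ
  have hps := ClassicalParam.sobolevBilin_pos hγ hlam
  have hss := ClassicalParam.sobolevBilin_symm hγ lam
  refine ⟨fun p => ⟨ClassicalParam.integrableOn_eval_mul_weight hγ p,
      ClassicalParam.integrableOn_eval_mul_weight hγ.succ p⟩,
    fun p hp0 => by rw [ClassicalParam.sobolevForm_eval hγ]; exact hps p hp0,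
    ⟨admitsLU_of_posDef hG hp, admitsLU_of_posDef hG' (ClassicalParam.bilin_pos hγ.succ),
      admitsLU_of_posDef hGs hps⟩,
    ⟨nonempty_lUFactorization hG hs hp,
      nonempty_lUFactorization hG' (ClassicalParam.bilin_symm hγ.succ)
        (ClassicalParam.bilin_pos hγ.succ),
      nonempty_lUFactorization hGs hss hps⟩, fun F F' Fs => ?_⟩
  have hP := F.isMonicOrthogonal_P₁ hG
  have hPs : ∀ k, Fs.P₁ k = F.P₁ k := fun k =>
    (Fs.isMonicOrthogonal_P₁ hGs k).unique hps ((hP k).sobolev lam)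
  have hnorm : ∀ k, γ.sobolevBilin hγ lam (F.P₁ k) (F.P₁ k) =
      F.h k + lam * (k : ℝ) ^ 2 * F'.h (k - 1) := fun k => by
    rw [(hP k).sobolevBilin_self (F'.isMonicOrthogonal_P₁ hG' (k - 1)), F.apply_P₁_self hG,
      F'.apply_P₁_self hG']
  refine ⟨fun k => ⟨(F.isMonicOrthogonal_P₂ hG hs k).unique hp (hP k), hPs k,
    (Fs.isMonicOrthogonal_P₂ hGs hss k).unique hps ((hP k).sobolev lam), ?_⟩,
    fun r k => ?_, fun r k => ?_⟩
  · rw [← Fs.apply_P₁_self hGs, hPs, hnorm]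
  · rw [ClassicalParam.form_eval hγ]
    split_ifs with h
    · rw [h, F.apply_P₁_self hG]
    · exact (hP r).apply_ne hs (hP k) h
  · rw [ClassicalParam.sobolevForm_eval hγ]
    split_ifs with h
    · rw [h, hnorm]
    · exact ((hP r).sobolev lam).apply_ne hss ((hP k).sobolev lam) h
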